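/- Let $k$ be a field, let $W$ be a finite group, and let $P$ be a locally finite poset on which $W$ acts by order-preserving maps. For $x\le y$ in $P$ let $W_{xy}=W_x\cap W_y$ be the common stabilizer, and let $\operatorname{VRep}(W_{xy})$ be the Grothendieck group of finite-dimensional representations of $W_{xy}$ over $k$. Let $\{r_{xy}\in\mathbb N\mid x\le y\}$ be a $W$-invariant weak rank function: $r_{xy}>0$ if $x<y$, $r_{xy}+r_{yz}=r_{xz}$ if $x\le y\le z$, and $r_{\sigma(x)\sigma(y)}=r_{xy}$ for $\sigma\in W$. Let $\mathcal C^W(P)$ be the category whose objects $V$ consist of finite-dimensional $k$-vector spaces $V_{xy}$ ($x\le y$ in $P$) and linear maps $\varphi^\sigma_{xy}:V_{xy}\to V_{\sigma(x)\sigma(y)}$ ($\sigma\in W$) with $\varphi^e_{xy}=\operatorname{id}$ and $\varphi^{\sigma'}_{\sigma(x)\sigma(y)}\circ\varphi^{\sigma}_{xy}=\varphi^{\sigma'\sigma}_{xy}$; morphisms are families of linear maps commuting with the $\varphi^\sigma$. The tensor product is $(U\otimes V)_{xz}=\bigoplus_{x\le y\le z}U_{xy}\otimes V_{yz}$. Let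 $I^W(P)$ be the Grothendieck ring of $\mathcal C^W(P)$, with unit $\delta$; an element $f$ of it has components $f_{xy}\in\operatorname{VRep}(W_{xy})$, where $[V]_{xy}=[V_{xy}]$, and is determined by them. Let $\mathscr I^W(P)$ be the ring of formal sums $f=\sum_{n\ge 0}f_nt^n$ with $f_n\in I^W(P)$ such that, for all $x\le y$, $f_{xy}(t)=\sum_n (f_n)_{xy}t^n$ is a polynomial of degree at most $r_{xy}$. Let $f\mapsto\bar f$ be the involution of $\mathscr I^W(P)$ given by $\bar f_{xy}(t)=t^{r_{xy}}f_{xy}(t^{-1})$. Let $\mathscr I^W_{1/2}(P)\subset\mathscr I^W(P)$ be the set of those $f$ with $\deg f_{xy}(t)<r_{xy}/2$ for all $x<y$ and $f_{xx}(t)=\delta_{xx}$ for all $x$. An element $\kappa\in\mathscr I^W(P)$ is a $P$-kernel if $\kappa_{xx}(t)=\delta_{xx}$ for all $x$ and $\bar\kappa=\kappa^{-1}$. Its right and left equivariant KLS-functions are the elements $f,g\in\mathscr I^W_{1/2}(P)$ with $\bar f=\kappa f$ and $\bar g=g\kappa$. **Proposition.** Let $\kappa\in\mathscr I^W(P)$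 be a $P$-kernel with right equivariant KLS-function $f$ and left equivariant KLS-function $g$, and let $Z=g\kappa f$ be the equivariant $Z$-function associated with $\kappa$. Then $Z\in\mathscr I^W(P)$ and $\bar Z=Z$; that is, $t^{r_{xy}}Z_{xy}(t^{-1})=Z_{xy}(t)$ for all $x\le y$ in $P$. -/

import Mathlib

open scoped TensorProduct DirectSum

universe u v

noncomputable section

/-! ### Grothendieck groups -/

/-- The Grothendieck group of a collection `C` of objects with a notion `ses A B D` of
"there is a short exact sequence `0 → A → B → D → 0`": the free abelian group on `C` modulo the
relations `[B] = [A] + [D]`. -/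
def GrothendieckGroup {C : Type*} (ses : C → C → C → Prop) : Type _ :=
  FreeAbelianGroup C ⧸ AddSubgroup.closure
    {a : FreeAbelianGroup C | ∃ A B D, ses A B D ∧
      a = FreeAbelianGroup.of B - FreeAbelianGroup.of A - FreeAbelianGroup.of D}

namespace GrothendieckGroup

variable {C : Type*} {ses : C → C → C → Prop}

instance : AddCommGroup (GrothendieckGroup ses) :=
  inferInstanceAs (AddCommGroup (FreeAbelianGroup C ⧸ AddSubgroup.closure _))

/-- The class `[A]` of an object. -/
def mk (ses : C → C → C → Prop) (A : C) : GrothendieckGroup ses :=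
  QuotientAddGroup.mk (FreeAbelianGroup.of A)

theorem mk_ses {A B D : C} (h : ses A B D) : mk ses B = mk ses A + mk ses D := by
  have : (QuotientAddGroup.mk (FreeAbelianGroup.of B - FreeAbelianGroup.of A -
      FreeAbelianGroup.of D) : GrothendieckGroup ses) = 0 :=
    (QuotientAddGroup.eq_zero_iff _).2 (AddSubgroup.subset_closure ⟨A, B, D, h, rfl⟩)
  have h2 : mk ses B - mk ses A - mk ses D = 0 := this
  rw [sub_sub, sub_eq_zero] at h2
  exact h2

/-- A function on objects that is additive on short exact sequences extends to the
Grothendieck group. -/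
def lift {G : Type*} [AddCommGroup G] (φ : C → G)
    (h : ∀ A B D, ses A B D → φ B = φ A + φ D) : GrothendieckGroup ses →+ G :=
  QuotientAddGroup.lift _ (FreeAbelianGroup.lift φ) (by
    rw [AddSubgroup.closure_le]
    rintro _ ⟨A, B, D, hs, rfl⟩
    simp [h A B D hs])

@[simp] theorem lift_mk {G : Type*} [AddCommGroup G] (φ : C → G)
    (h : ∀ A B D, ses A B D → φ B = φ A + φ D) (A : C) : lift φ h (mk ses A) = φ A :=
  FreeAbelianGroup.lift_apply_of φ A

theorem hom_ext {G : Type*} [AddCommGroup G] {φ ψ : GrothendieckGroup ses →+ G}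
    (h : ∀ A, φ (mk ses A) = ψ (mk ses A)) : φ = ψ :=
  QuotientAddGroup.addMonoidHom_ext _ (FreeAbelianGroup.lift_ext _ _ h)

end GrothendieckGroup

/-! ### Virtual representations -/

/-- Existence of a short exact sequence `0 → A → B → D → 0` of finite dimensional
representations of `G` over `k`. -/
def FDRep.SES {k : Type u} [Field k] {G : Type v} [Group G] (A B D : FDRep k G) : Prop :=
  ∃ (i : A →ₗ[k] B) (p : B →ₗ[k] D),
    (∀ g a, i (A.ρ g a) = B.ρ g (i a)) ∧ (∀ g b, p (B.ρ g b) = D.ρ g (p b)) ∧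
    Function.Injective i ∧ Function.Exact i p ∧ Function.Surjective p

/-- The (additive group of the) ring of finite dimensional virtual representations of `G`
over `k`. -/
abbrev VRep (k : Type u) [Field k] (G : Type v) [Group G] :=
  GrothendieckGroup (FDRep.SES (k := k) (G := G))

/-! ### The category `C^W(P)` -/

section

variable (k : Type u) [Field k] (W : Type v) [Group W] (P : Type u) [PartialOrder P]
  [MulAction W P]

/-- An object of `C^W(P)`: finite dimensional vector spaces `V x y` for `x ≤ y` in `P`,
together with linear maps `V x y → V (σ x) (σ y)` for `σ ∈ W`, subject to the identity and
composition laws. (The target is written `V x' y'` with `σ x = x'` and `σ y = y'`.) -/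
structure IntervalRep where
  V : ∀ (x y : P), x ≤ y → Type u
  [addCommGroup : ∀ x y h, AddCommGroup (V x y h)]
  [module : ∀ x y h, Module k (V x y h)]
  [finite : ∀ x y h, Module.Finite k (V x y h)]
  act : ∀ (σ : W) {x y x' y' : P}, σ • x = x' → σ • y = y' → ∀ (h : x ≤ y) (h' : x' ≤ y'),
    V x y h →ₗ[k] V x' y' h'
  act_one : ∀ {x y : P} (hx : (1 : W) • x = x) (hy : (1 : W) • y = y) (h : x ≤ y)
    (v : V x y h), act 1 hx hy h h v = v
  act_mul : ∀ (τ σ : W) {x y x' y' x'' y'' : P} (hx : σ • x = x') (hy : σ • y = y')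
    (hx' : τ • x' = x'') (hy' : τ • y' = y'') (hx'' : (τ * σ) • x = x'')
    (hy'' : (τ * σ) • y = y'') (h : x ≤ y) (h' : x' ≤ y') (h'' : x'' ≤ y'') (v : V x y h),
    act τ hx' hy' h' h'' (act σ hx hy h h' v) = act (τ * σ) hx'' hy'' h h'' v

end

namespace IntervalRep

attribute [instance] addCommGroup module finite

variable {k : Type u} [Field k] {W : Type v} [Group W] {P : Type u} [PartialOrder P]
  [MulAction W P]

/-- A morphism of `C^W(P)`: a family of linear maps compatible with the action of `W`. -/
@[ext] structure Hom (U V : IntervalRep k W P) where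
  app : ∀ x y (h : x ≤ y), U.V x y h →ₗ[k] V.V x y h
  comm : ∀ (σ : W) {x y x' y' : P} (hx : σ • x = x') (hy : σ • y = y') (h : x ≤ y)
    (h' : x' ≤ y') (u : U.V x y h),
    app x' y' h' (U.act σ hx hy h h' u) = V.act σ hx hy h h' (app x y h u)

/-- Existence of a short exact sequence `0 → A → B → D → 0` in `C^W(P)`. -/
def SES (A B D : IntervalRep k W P) : Prop :=
  ∃ (i : Hom A B) (p : Hom B D), ∀ x y h, Function.Injective (i.app x y h) ∧
    Function.Exact (i.app x y h) (p.app x y h) ∧ Function.Surjective (p.app x y h)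

/-- The stabilizer `W_{xy} = W_x ∩ W_y`. -/
abbrev stab (W : Type v) [Group W] {P : Type u} [MulAction W P] (x y : P) : Subgroup W :=
  MulAction.stabilizer W x ⊓ MulAction.stabilizer W y

/-- The representation of `W_{xy}` on `V x y`. -/
def rep (V : IntervalRep k W P) (x y : P) (h : x ≤ y) : FDRep k (stab W x y) :=
  FDRep.of (V := V.V x y h)
    { toFun := fun σ => V.act σ.1 σ.2.1 σ.2.2 h h
      map_one' := LinearMap.ext fun v => V.act_one _ _ h v
      map_mul' := fun τ σ => LinearMap.ext fun v =>
        (V.act_mul τ.1 σ.1 σ.2.1 σ.2.2 τ.2.1 τ.2.2 (τ * σ).2.1 (τ * σ).2.2 h h h v).symm }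

theorem rep_ses {A B D : IntervalRep k W P} (hs : SES A B D) (x y : P) (h : x ≤ y) :
    FDRep.SES (A.rep x y h) (B.rep x y h) (D.rep x y h) := by
  obtain ⟨i, p, hip⟩ := hs
  exact ⟨i.app x y h, p.app x y h, fun g a => i.comm g.1 g.2.1 g.2.2 h h a,
    fun g a => p.comm g.1 g.2.1 g.2.2 h h a, hip x y h⟩

/-- The unit object: `V x x` is the trivial one-dimensional representation of `W_x`, and
`V x y = 0` for `x < y`. -/
def unit : IntervalRep k W P where
  V x y _ := PLift (x = y) → k
  act σ {x y x' y'} hx hy _ _ := LinearMap.funLeft k k fun e =>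
    ⟨by have := e.down; rw [← hx, ← hy] at this; exact MulAction.injective σ this⟩
  act_one _ _ _ _ := rfl
  act_mul _ _ _ _ _ _ _ _ _ _ _ _ _ _ _ _ _ _ := rfl

/-- The identity morphism. -/
def Hom.id (U : IntervalRep k W P) : Hom U U where
  app _ _ _ := LinearMap.id
  comm _ _ _ _ _ _ _ _ _ _ := rfl

/-- The zero object. -/
def zero : IntervalRep k W P where
  V _ _ _ := PUnit
  act _ _ _ _ _ _ _ _ _ := 0
  act_one _ _ _ _ := rfl
  act_mul _ _ _ _ _ _ _ _ _ _ _ _ _ _ _ _ _ _ := rfl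

/-- Isomorphic objects have the same class. -/
theorem mk_eq {U V : IntervalRep k W P} (f : Hom U V)
    (hf : ∀ x y h, Function.Bijective (f.app x y h)) :
    GrothendieckGroup.mk SES U = GrothendieckGroup.mk SES V := by
  have hz : SES (zero : IntervalRep k W P) zero zero :=
    ⟨Hom.id _, Hom.id _, fun _ _ _ => ⟨fun _ _ h => h, fun _ => ⟨fun _ => ⟨0, rfl⟩, fun _ => rfl⟩,
      fun b => ⟨b, rfl⟩⟩⟩
  have h0 := GrothendieckGroup.mk_ses hz
  have hs : SES zero U V := by
    refine ⟨⟨fun _ _ _ => 0, fun σ _ _ _ _ hx hy h h' _ => ((U.act σ hx hy h h').map_zero).symm⟩,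
      f, fun x y h => ⟨fun _ _ _ => rfl, fun b => ⟨fun hb => ⟨0, ?_⟩, ?_⟩, (hf x y h).2⟩⟩
    · exact ((hf x y h).1 (hb.trans (map_zero _).symm)).symm
    · rintro ⟨_, rfl⟩; exact map_zero _
  have h1 := GrothendieckGroup.mk_ses hs
  have h2 : GrothendieckGroup.mk SES (zero : IntervalRep k W P) = 0 := by
    simpa using h0
  rw [h1, h2, zero_add]

open Classical in
theorem tensor_aux (U V : IntervalRep k W P) {x z x' z' : P} (σ : W) (hx : σ • x = x')
    (hz : σ • z = z') (y : Set.Icc x z) (y₁ y₂ : Set.Icc x' z') (h₁ : σ • y.1 = y₁.1)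
    (h₂ : σ • y.1 = y₂.1) (t : U.V x y y.2.1 ⊗[k] V.V y z y.2.2) :
    DirectSum.lof k (Set.Icc x' z') (fun y => U.V x' y y.2.1 ⊗[k] V.V y z' y.2.2) y₁
      (TensorProduct.map (U.act σ hx h₁ y.2.1 y₁.2.1) (V.act σ h₁ hz y.2.2 y₁.2.2) t) =
    DirectSum.lof k (Set.Icc x' z') (fun y => U.V x' y y.2.1 ⊗[k] V.V y z' y.2.2) y₂
      (TensorProduct.map (U.act σ hx h₂ y.2.1 y₂.2.1) (V.act σ h₂ hz y.2.2 y₂.2.2) t) := by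
  obtain rfl : y₁ = y₂ := Subtype.ext (h₁.symm.trans h₂)
  rfl

open Classical in
/-- Two linear maps out of `(U ⊗ V) x z` agree if they agree on the elements `u ⊗ v` of the
summands. -/
theorem tensor_hom_ext {U V : IntervalRep k W P} {x z : P} {N : Type*} [AddCommGroup N]
    [Module k N]
    {φ ψ : (⨁ y : Set.Icc x z, U.V x y y.2.1 ⊗[k] V.V y z y.2.2) →ₗ[k] N}
    (h : ∀ (y : Set.Icc x z) a b,
      φ (DirectSum.lof k _ (fun y : Set.Icc x z => U.V x y y.2.1 ⊗[k] V.V y z y.2.2) y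
        (a ⊗ₜ b)) =
      ψ (DirectSum.lof k _ (fun y : Set.Icc x z => U.V x y y.2.1 ⊗[k] V.V y z y.2.2) y
        (a ⊗ₜ b))) : φ = ψ :=
  DirectSum.linearMap_ext k fun y => TensorProduct.ext' fun a b => h y a b

theorem mem_Icc_smul [CovariantClass W P HSMul.hSMul LE.le] {x z x' z' : P} (σ : W) (hx : σ • x = x')
    (hz : σ • z = z') (y : Set.Icc x z) : σ • y.1 ∈ Set.Icc x' z' :=
  ⟨hx ▸ smul_mono_right σ y.2.1, hz ▸ smul_mono_right σ y.2.2⟩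

variable [CovariantClass W P HSMul.hSMul LE.le]

open Classical in
/-- The action on the tensor product: `u ⊗ v ↦ σ u ⊗ σ v`, taking the summand of `y` to the
summand of `σ y`. -/
def tensorAct (U V : IntervalRep k W P) (σ : W) {x z x' z' : P} (hx : σ • x = x')
    (hz : σ • z = z') :
    (⨁ y : Set.Icc x z, U.V x y y.2.1 ⊗[k] V.V y z y.2.2) →ₗ[k]
      ⨁ y : Set.Icc x' z', U.V x' y y.2.1 ⊗[k] V.V y z' y.2.2 :=
  DirectSum.toModule k _ _ fun y =>
    DirectSum.lof k (Set.Icc x' z') (fun y => U.V x' y y.2.1 ⊗[k] V.V y z' y.2.2)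
        ⟨σ • y.1, mem_Icc_smul σ hx hz y⟩ ∘ₗ
      TensorProduct.map (U.act σ hx rfl y.2.1 (mem_Icc_smul σ hx hz y).1)
        (V.act σ rfl hz y.2.2 (mem_Icc_smul σ hx hz y).2)

open Classical in
theorem tensorAct_lof (U V : IntervalRep k W P) (σ : W) {x z x' z' : P} (hx : σ • x = x')
    (hz : σ • z = z') (y : Set.Icc x z) (y' : Set.Icc x' z') (hy : σ • y.1 = y'.1)
    (a : U.V x y y.2.1) (b : V.V y z y.2.2) :
    tensorAct U V σ hx hz
      (DirectSum.lof k _ (fun y : Set.Icc x z => U.V x y y.2.1 ⊗[k] V.V y z y.2.2) y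
        (a ⊗ₜ b)) =
    DirectSum.lof k _ (fun y : Set.Icc x' z' => U.V x' y y.2.1 ⊗[k] V.V y z' y.2.2) y'
      (U.act σ hx hy y.2.1 y'.2.1 a ⊗ₜ V.act σ hy hz y.2.2 y'.2.2 b) := by
  rw [tensorAct, DirectSum.toModule_lof, LinearMap.comp_apply]
  exact tensor_aux U V σ hx hz y ⟨σ • y.1, mem_Icc_smul σ hx hz y⟩ y' rfl hy (a ⊗ₜ b)

variable [LocallyFiniteOrder P]

/-- The tensor product in `C^W(P)`: `(U ⊗ V) x z = ⨁_{x ≤ y ≤ z} U x y ⊗ V y z`. -/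
def tensor (U V : IntervalRep k W P) : IntervalRep k W P where
  V x z _ := ⨁ y : Set.Icc x z, U.V x y y.2.1 ⊗[k] V.V y z y.2.2
  act σ _ _ _ _ hx hz _ _ := tensorAct U V σ hx hz
  act_one {x z} hx hz h v := by
    classical
    have : tensorAct U V 1 hx hz = LinearMap.id := tensor_hom_ext fun y a b => by
      rw [tensorAct_lof U V 1 hx hz y y (one_smul _ _), U.act_one, V.act_one]; rfl
    rw [this]; rfl
  act_mul τ σ x z x' z' x'' z'' hx hz hx' hz' hx'' hz'' h h' h'' v := by
    classical
    have : tensorAct U V τ hx' hz' ∘ₗ tensorAct U V σ hx hz = tensorAct U V (τ * σ) hx'' hz'' :=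
      tensor_hom_ext fun y a b => by
        have e : τ • σ • y.1 = (τ * σ) • y.1 := (mul_smul _ _ _).symm
        have m := mem_Icc_smul σ hx hz y
        have m' := mem_Icc_smul τ hx' hz' ⟨_, m⟩
        rw [LinearMap.comp_apply, tensorAct_lof U V σ hx hz y ⟨_, m⟩ rfl,
          tensorAct_lof U V τ hx' hz' ⟨_, m⟩ ⟨_, m'⟩ rfl,
          tensorAct_lof U V (τ * σ) hx'' hz'' y ⟨_, m'⟩ e.symm]
        rw [U.act_mul, V.act_mul]
    exact LinearMap.congr_fun this v

open Classical in
theorem tensor_act_lof (U V : IntervalRep k W P) (σ : W) {x z x' z' : P} (hx : σ • x = x')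
    (hz : σ • z = z') (h : x ≤ z) (h' : x' ≤ z') (y : Set.Icc x z) (y' : Set.Icc x' z')
    (hy : σ • y.1 = y'.1) (a : U.V x y y.2.1) (b : V.V y z y.2.2) :
    (tensor U V).act σ hx hz h h'
      (DirectSum.lof k _ (fun y : Set.Icc x z => U.V x y y.2.1 ⊗[k] V.V y z y.2.2) y
        (a ⊗ₜ b)) =
    DirectSum.lof k _ (fun y : Set.Icc x' z' => U.V x' y y.2.1 ⊗[k] V.V y z' y.2.2) y'
      (U.act σ hx hy y.2.1 y'.2.1 a ⊗ₜ V.act σ hy hz y.2.2 y'.2.2 b) :=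
  tensorAct_lof U V σ hx hz y y' hy a b

/-- Functoriality of the tensor product. -/
def tensorMap {U U' V V' : IntervalRep k W P} (f : Hom U U') (g : Hom V V') :
    Hom (tensor U V) (tensor U' V') where
  app x z _ := DirectSum.lmap fun y : Set.Icc x z =>
    TensorProduct.map (f.app x y y.2.1) (g.app y z y.2.2)
  comm σ {x z x' z'} hx hz h h' u := by
    classical
    have : (DirectSum.lmap fun y : Set.Icc x' z' =>
          TensorProduct.map (f.app x' y y.2.1) (g.app y z' y.2.2)) ∘ₗ tensorAct U V σ hx hz =
        tensorAct U' V' σ hx hz ∘ₗ (DirectSum.lmap fun y : Set.Icc x z =>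
          TensorProduct.map (f.app x y y.2.1) (g.app y z y.2.2)) :=
      tensor_hom_ext fun y a b => by
        have m := mem_Icc_smul σ hx hz y
        rw [LinearMap.comp_apply, LinearMap.comp_apply,
          tensorAct_lof U V σ hx hz y ⟨_, m⟩ rfl, DirectSum.lmap_lof, DirectSum.lmap_lof,
          TensorProduct.map_tmul, TensorProduct.map_tmul,
          tensorAct_lof U' V' σ hx hz y ⟨_, m⟩ rfl, f.comm, g.comm]
    exact LinearMap.congr_fun this u

theorem exact_lmap {ι : Type*} {A B D : ι → Type*} [∀ i, AddCommGroup (A i)]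
    [∀ i, AddCommGroup (B i)] [∀ i, AddCommGroup (D i)] [∀ i, Module k (A i)]
    [∀ i, Module k (B i)] [∀ i, Module k (D i)] (f : ∀ i, A i →ₗ[k] B i)
    (g : ∀ i, B i →ₗ[k] D i) (h : ∀ i, Function.Exact (f i) (g i)) :
    Function.Exact (DirectSum.lmap f) (DirectSum.lmap g) := by
  rw [LinearMap.exact_iff, DirectSum.range_lmap, DirectSum.ker_lmap]
  simp_rw [fun i => (LinearMap.exact_iff.1 (h i))]

theorem tensor_ses_right (U : IntervalRep k W P) {A B D : IntervalRep k W P} (h : SES A B D) :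
    SES (tensor U A) (tensor U B) (tensor U D) := by
  obtain ⟨i, p, hip⟩ := h
  refine ⟨tensorMap (Hom.id U) i, tensorMap (Hom.id U) p, fun x z hxz => ⟨?_, ?_, ?_⟩⟩
  · exact (DirectSum.lmap_injective _).2 fun (y : Set.Icc x z) =>
      Module.Flat.lTensor_preserves_injective_linearMap _ (hip y z y.2.2).1
  · exact exact_lmap _ _ fun (y : Set.Icc x z) =>
      lTensor_exact _ (hip y z y.2.2).2.1 (hip y z y.2.2).2.2
  · exact (DirectSum.lmap_surjective _).2 fun (y : Set.Icc x z) => LinearMap.lTensor_surjective _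
      (hip y z y.2.2).2.2

theorem tensor_ses_left (U : IntervalRep k W P) {A B D : IntervalRep k W P} (h : SES A B D) :
    SES (tensor A U) (tensor B U) (tensor D U) := by
  obtain ⟨i, p, hip⟩ := h
  refine ⟨tensorMap i (Hom.id U), tensorMap p (Hom.id U), fun x z hxz => ⟨?_, ?_, ?_⟩⟩
  · exact (DirectSum.lmap_injective _).2 fun (y : Set.Icc x z) =>
      Module.Flat.rTensor_preserves_injective_linearMap _ (hip x y y.2.1).1
  · exact exact_lmap _ _ fun (y : Set.Icc x z) =>
      rTensor_exact _ (hip x y y.2.1).2.1 (hip x y y.2.1).2.2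
  · exact (DirectSum.lmap_surjective _).2 fun (y : Set.Icc x z) => LinearMap.rTensor_surjective _
      (hip x y y.2.1).2.2

/-! ### The ring structure -/

/-- The summand `u ⊗ v` of the tensor product, for `u` in `U x y` and `v` in `V y z`. -/
def pure (U V : IntervalRep k W P) {x z : P} (h : x ≤ z) (y : Set.Icc x z) (a : U.V x y y.2.1)
    (b : V.V y z y.2.2) : (tensor U V).V x z h := by
  classical
  exact DirectSum.lof k _ (fun y : Set.Icc x z => U.V x y y.2.1 ⊗[k] V.V y z y.2.2) y (a ⊗ₜ b)

theorem pure_act (U V : IntervalRep k W P) (σ : W) {x z x' z' : P} (hx : σ • x = x')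
    (hz : σ • z = z') (h : x ≤ z) (h' : x' ≤ z') (y : Set.Icc x z) (y' : Set.Icc x' z')
    (hy : σ • y.1 = y'.1) (a : U.V x y y.2.1) (b : V.V y z y.2.2) :
    (tensor U V).act σ hx hz h h' (pure U V h y a b) =
      pure U V h' y' (U.act σ hx hy y.2.1 y'.2.1 a) (V.act σ hy hz y.2.2 y'.2.2 b) :=
  tensorAct_lof U V σ hx hz y y' hy a b

/-- Construction of linear maps out of the tensor product. -/
def elim (U V : IntervalRep k W P) {x z : P} (h : x ≤ z) {N : Type*} [AddCommGroup N]
    [Module k N] (φ : ∀ y : Set.Icc x z, U.V x y y.2.1 →ₗ[k] V.V y z y.2.2 →ₗ[k] N) :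
    (tensor U V).V x z h →ₗ[k] N := by
  classical
  exact DirectSum.toModule k _ _ fun y => TensorProduct.lift (φ y)

@[simp] theorem elim_pure (U V : IntervalRep k W P) {x z : P} (h : x ≤ z) {N : Type*}
    [AddCommGroup N] [Module k N]
    (φ : ∀ y : Set.Icc x z, U.V x y y.2.1 →ₗ[k] V.V y z y.2.2 →ₗ[k] N) (y : Set.Icc x z)
    (a : U.V x y y.2.1) (b : V.V y z y.2.2) : elim U V h φ (pure U V h y a b) = φ y a b := by
  classical
  have : elim U V h φ (pure U V h y a b) = TensorProduct.lift (φ y) (a ⊗ₜ[k] b) :=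
    DirectSum.toModule_lof (φ := fun y => TensorProduct.lift (φ y)) k y (a ⊗ₜ[k] b)
  rw [this, TensorProduct.lift.tmul]

theorem pure_ext {U V : IntervalRep k W P} {x z : P} {h : x ≤ z} {N : Type*}
    [AddCommGroup N] [Module k N] {φ ψ : (tensor U V).V x z h →ₗ[k] N}
    (e : ∀ y a b, φ (pure U V h y a b) = ψ (pure U V h y a b)) : φ = ψ :=
  tensor_hom_ext e

/-- `pure` as a bilinear map. -/
def pureₗ (U V : IntervalRep k W P) {x z : P} (h : x ≤ z) (y : Set.Icc x z) :
    U.V x y y.2.1 →ₗ[k] V.V y z y.2.2 →ₗ[k] (tensor U V).V x z h := by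
  classical
  exact (TensorProduct.mk k _ _).compr₂
    (DirectSum.lof k _ (fun y : Set.Icc x z => U.V x y y.2.1 ⊗[k] V.V y z y.2.2) y)

@[simp] theorem pureₗ_apply (U V : IntervalRep k W P) {x z : P} (h : x ≤ z) (y : Set.Icc x z)
    (a : U.V x y y.2.1) (b : V.V y z y.2.2) : pureₗ U V h y a b = pure U V h y a b := rfl

theorem mk_tensor_assoc (A B D : IntervalRep k W P) :
    GrothendieckGroup.mk SES (tensor (tensor A B) D) =
      GrothendieckGroup.mk SES (tensor A (tensor B D)) := by
  let F : ∀ x w (h : x ≤ w), (tensor (tensor A B) D).V x w h →ₗ[k]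
      (tensor A (tensor B D)).V x w h := fun x w h =>
    elim (tensor A B) D h fun z => elim A B z.2.1 fun y =>
      LinearMap.mk₂ k (fun a b => (pureₗ A (tensor B D) h ⟨y, y.2.1, y.2.2.trans z.2.2⟩ a) ∘ₗ
          (pureₗ B D (y.2.2.trans z.2.2) ⟨z, y.2.2, z.2.2⟩ b))
        (fun _ _ _ => by ext; simp [-pureₗ_apply]) (fun _ _ _ => by ext; simp [-pureₗ_apply])
        (fun _ _ _ => by ext; simp [-pureₗ_apply]) (fun _ _ _ => by ext; simp [-pureₗ_apply])
  let G : ∀ x w (h : x ≤ w), (tensor A (tensor B D)).V x w h →ₗ[k]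
      (tensor (tensor A B) D).V x w h := fun x w h =>
    elim A (tensor B D) h fun y => LinearMap.flip (elim B D y.2.2 fun z =>
      LinearMap.mk₂ k (fun b d =>
          ((pureₗ (tensor A B) D h ⟨z, y.2.1.trans z.2.1, z.2.2⟩).flip d) ∘ₗ
            ((pureₗ A B (y.2.1.trans z.2.1) ⟨y, y.2.1, z.2.1⟩).flip b))
        (fun _ _ _ => by ext; simp [-pureₗ_apply]) (fun _ _ _ => by ext; simp [-pureₗ_apply])
        (fun _ _ _ => by ext; simp [-pureₗ_apply]) (fun _ _ _ => by ext; simp [-pureₗ_apply]))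
  have hF : ∀ x w h z (y : Set.Icc x z.1) a b d,
      F x w h (pure (tensor A B) D h z (pure A B z.2.1 y a b) d) =
        pure A (tensor B D) h ⟨y, y.2.1, y.2.2.trans z.2.2⟩ a
          (pure B D (y.2.2.trans z.2.2) ⟨z, y.2.2, z.2.2⟩ b d) := fun x w h z y a b d => by
    simp only [F, elim_pure]; rfl
  have hG : ∀ x w h y (z : Set.Icc y.1 w) a b d,
      G x w h (pure A (tensor B D) h y a (pure B D y.2.2 z b d)) =
        pure (tensor A B) D h ⟨z, y.2.1.trans z.2.1, z.2.2⟩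
          (pure A B (y.2.1.trans z.2.1) ⟨y, y.2.1, z.2.1⟩ a b) d := fun x w h y z a b d => by
    simp only [G, elim_pure, LinearMap.flip_apply]; rfl
  have extL : ∀ {x w : P} {h : x ≤ w} {N : Type u} [AddCommGroup N] [Module k N]
      {φ ψ : (tensor (tensor A B) D).V x w h →ₗ[k] N},
      (∀ z (y : Set.Icc x z.1) a b d,
        φ (pure (tensor A B) D h z (pure A B z.2.1 y a b) d) =
          ψ (pure (tensor A B) D h z (pure A B z.2.1 y a b) d)) → φ = ψ := by
    intro x w h N _ _ φ ψ e
    refine pure_ext fun z t d => ?_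
    have : φ ∘ₗ (pureₗ (tensor A B) D h z).flip d = ψ ∘ₗ (pureₗ (tensor A B) D h z).flip d :=
      pure_ext fun y a b => e z y a b d
    exact LinearMap.congr_fun this t
  have extR : ∀ {x w : P} {h : x ≤ w} {N : Type u} [AddCommGroup N] [Module k N]
      {φ ψ : (tensor A (tensor B D)).V x w h →ₗ[k] N},
      (∀ y (z : Set.Icc y.1 w) a b d,
        φ (pure A (tensor B D) h y a (pure B D y.2.2 z b d)) =
          ψ (pure A (tensor B D) h y a (pure B D y.2.2 z b d))) → φ = ψ := by
    intro x w h N _ _ φ ψ e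
    refine pure_ext fun y a t => ?_
    have : φ ∘ₗ pureₗ A (tensor B D) h y a = ψ ∘ₗ pureₗ A (tensor B D) h y a :=
      pure_ext fun z b d => e y z a b d
    exact LinearMap.congr_fun this t
  refine mk_eq ⟨F, ?_⟩ fun x w h => ?_
  · intro σ x w x' w' hx hw h h' t
    have : F x' w' h' ∘ₗ (tensor (tensor A B) D).act σ hx hw h h' =
        (tensor A (tensor B D)).act σ hx hw h h' ∘ₗ F x w h := extL fun z y a b d => by
      have mz := mem_Icc_smul σ hx hw z
      have my := mem_Icc_smul σ hx (rfl : σ • z.1 = _) y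
      simp only [LinearMap.comp_apply]
      rw [hF, pure_act (tensor A B) D σ hx hw h h' z ⟨_, mz⟩ rfl,
        pure_act A B σ hx rfl z.2.1 mz.1 y ⟨_, my⟩ rfl, hF,
        pure_act A (tensor B D) σ hx hw h h' _ ⟨σ • y.1, my.1, my.2.trans mz.2⟩ rfl,
        pure_act B D σ rfl hw _ (my.2.trans mz.2) _ ⟨σ • z.1, my.2, mz.2⟩ rfl]
    exact LinearMap.congr_fun this t
  · have h1 : G x w h ∘ₗ F x w h = LinearMap.id := extL fun z y a b d => by
      rw [LinearMap.comp_apply, hF, hG]; rfl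
    have h2 : F x w h ∘ₗ G x w h = LinearMap.id := extR fun y z a b d => by
      rw [LinearMap.comp_apply, hG, hF]; rfl
    exact Function.bijective_iff_has_inverse.2
      ⟨G x w h, LinearMap.congr_fun h1, LinearMap.congr_fun h2⟩

theorem mk_unit_tensor (V : IntervalRep k W P) :
    GrothendieckGroup.mk SES (tensor unit V) = GrothendieckGroup.mk SES V := by
  let F : ∀ x z (h : x ≤ z), (tensor unit V).V x z h →ₗ[k] V.V x z h := fun x z h =>
    elim unit V h fun y => by
      classical
      exact if e : x = y then
        LinearMap.mk₂ k (fun (a : PLift (x = y.1) → k) v => a ⟨e⟩ • V.act 1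
            ((one_smul _ _).trans e.symm) (one_smul _ _) y.2.2 h v)
          (fun _ _ _ => add_smul _ _ _) (fun _ _ _ => mul_smul _ _ _)
          (fun _ _ _ => by rw [map_add, smul_add])
          (fun _ _ _ => by rw [map_smul, smul_comm])
      else 0
  have hF : ∀ x z h (a : PLift (x = x) → k) v,
      F x z h (pure unit V h ⟨x, Set.left_mem_Icc.2 h⟩ a v) = a ⟨rfl⟩ • v := fun x z h a v => by
    refine (elim_pure _ _ h _ _ _ _).trans ?_
    rw [dif_pos rfl]
    exact congrArg (a ⟨rfl⟩ • ·) (V.act_one _ _ _ v)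
  let G : ∀ x z (h : x ≤ z), V.V x z h →ₗ[k] (tensor unit V).V x z h := fun x z h =>
    pureₗ unit V h ⟨x, Set.left_mem_Icc.2 h⟩ (fun _ => 1)
  have ext : ∀ {x z : P} {h : x ≤ z} {N : Type u} [AddCommGroup N] [Module k N]
      {φ ψ : (tensor unit V).V x z h →ₗ[k] N},
      (∀ v, φ (pure unit V h ⟨x, Set.left_mem_Icc.2 h⟩ (fun _ => 1) v) =
          ψ (pure unit V h ⟨x, Set.left_mem_Icc.2 h⟩ (fun _ => 1) v)) → φ = ψ := by
    intro x z h N _ _ φ ψ e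
    refine pure_ext fun y a v => ?_
    obtain ⟨y, hy⟩ := y
    by_cases hxy : x = y
    · subst hxy
      have ha : a = a ⟨rfl⟩ • (fun _ => 1 : PLift (x = x) → k) := by
        funext i; exact (mul_one _).symm
      have hp : pure unit V h ⟨x, hy⟩ a v =
          a ⟨rfl⟩ • pure unit V h ⟨x, hy⟩ (fun _ => 1 : PLift (x = x) → k) v := by
        conv_lhs => rw [ha]
        exact LinearMap.congr_fun ((pureₗ unit V h ⟨x, hy⟩).map_smul _ _) v
      rw [hp, map_smul, map_smul, e]
    · have ha : a = 0 := by funext i; exact absurd i.down hxy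
      have hp : pure unit V h ⟨y, hy⟩ a v = 0 := by
        rw [ha]; exact LinearMap.congr_fun ((pureₗ unit V h ⟨y, hy⟩).map_zero) v
      rw [hp, map_zero, map_zero]
  refine mk_eq ⟨F, ?_⟩ fun x z h => ?_
  · intro σ x z x' z' hx hz h h' t
    have : F x' z' h' ∘ₗ (tensor unit V).act σ hx hz h h' =
        V.act σ hx hz h h' ∘ₗ F x z h := ext fun v => by
      simp only [LinearMap.comp_apply]
      rw [hF]
      refine (congrArg (F x' z' h') (pure_act unit V σ hx hz h h' ⟨x, Set.left_mem_Icc.2 h⟩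
        ⟨x', Set.left_mem_Icc.2 h'⟩ hx (fun _ => 1) v)).trans ?_
      exact (hF _ _ _ _ _).trans ((one_smul k _).trans (congrArg _ (one_smul k v).symm))
    exact LinearMap.congr_fun this t
  · have h1 : G x z h ∘ₗ F x z h = LinearMap.id := ext fun v => by
      rw [LinearMap.comp_apply, hF]
      exact congrArg (G x z h) (one_smul k v)
    exact Function.bijective_iff_has_inverse.2
      ⟨G x z h, LinearMap.congr_fun h1, fun v => (hF _ _ _ _ _).trans (one_smul k v)⟩

theorem mk_tensor_unit (V : IntervalRep k W P) :
    GrothendieckGroup.mk SES (tensor V unit) = GrothendieckGroup.mk SES V := by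
  let F : ∀ x z (h : x ≤ z), (tensor V unit).V x z h →ₗ[k] V.V x z h := fun x z h =>
    elim V unit h fun y => by
      classical
      exact if e : y = z then
        LinearMap.mk₂ k (fun v (a : PLift (y.1 = z) → k) => a ⟨e⟩ • V.act 1
            (one_smul _ _) ((one_smul _ _).trans e) y.2.1 h v)
          (fun _ _ _ => by rw [map_add, smul_add])
          (fun _ _ _ => by rw [map_smul, smul_comm])
          (fun _ _ _ => add_smul _ _ _) (fun _ _ _ => mul_smul _ _ _)
      else 0
  have hF : ∀ x z h (a : PLift (z = z) → k) v,
      F x z h (pure V unit h ⟨z, Set.right_mem_Icc.2 h⟩ v a) = a ⟨rfl⟩ • v := fun x z h a v => by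
    refine (elim_pure _ _ h _ _ _ _).trans ?_
    rw [dif_pos rfl]
    exact congrArg (a ⟨rfl⟩ • ·) (V.act_one _ _ _ v)
  let G : ∀ x z (h : x ≤ z), V.V x z h →ₗ[k] (tensor V unit).V x z h := fun x z h =>
    (pureₗ V unit h ⟨z, Set.right_mem_Icc.2 h⟩).flip (fun _ => 1)
  have ext : ∀ {x z : P} {h : x ≤ z} {N : Type u} [AddCommGroup N] [Module k N]
      {φ ψ : (tensor V unit).V x z h →ₗ[k] N},
      (∀ v, φ (pure V unit h ⟨z, Set.right_mem_Icc.2 h⟩ v (fun _ => 1)) =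
          ψ (pure V unit h ⟨z, Set.right_mem_Icc.2 h⟩ v (fun _ => 1))) → φ = ψ := by
    intro x z h N _ _ φ ψ e
    refine pure_ext fun y v a => ?_
    obtain ⟨y, hy⟩ := y
    by_cases hxy : y = z
    · subst hxy
      have ha : a = a ⟨rfl⟩ • (fun _ => 1 : PLift (y = y) → k) := by
        funext i; exact (mul_one _).symm
      have hp : pure V unit h ⟨y, hy⟩ v a =
          a ⟨rfl⟩ • pure V unit h ⟨y, hy⟩ v (fun _ => 1 : PLift (y = y) → k) := by
        conv_lhs => rw [ha]
        exact (pureₗ V unit h ⟨y, hy⟩ v).map_smul _ _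
      rw [hp, map_smul, map_smul, e]
    · have ha : a = 0 := by funext i; exact absurd i.down hxy
      have hp : pure V unit h ⟨y, hy⟩ v a = 0 := by
        rw [ha]; exact (pureₗ V unit h ⟨y, hy⟩ v).map_zero
      rw [hp, map_zero, map_zero]
  refine mk_eq ⟨F, ?_⟩ fun x z h => ?_
  · intro σ x z x' z' hx hz h h' t
    have : F x' z' h' ∘ₗ (tensor V unit).act σ hx hz h h' =
        V.act σ hx hz h h' ∘ₗ F x z h := ext fun v => by
      simp only [LinearMap.comp_apply]
      rw [hF]
      refine (congrArg (F x' z' h') (pure_act V unit σ hx hz h h' ⟨z, Set.right_mem_Icc.2 h⟩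
        ⟨z', Set.right_mem_Icc.2 h'⟩ hz v (fun _ => 1))).trans ?_
      exact (hF _ _ _ _ _).trans ((one_smul k _).trans (congrArg _ (one_smul k v).symm))
    exact LinearMap.congr_fun this t
  · have h1 : G x z h ∘ₗ F x z h = LinearMap.id := ext fun v => by
      rw [LinearMap.comp_apply, hF]
      exact congrArg (G x z h) (one_smul k v)
    exact Function.bijective_iff_has_inverse.2
      ⟨G x z h, LinearMap.congr_fun h1, fun v => (hF _ _ _ _ _).trans (one_smul k v)⟩

end IntervalRep

/-- The equivariant incidence algebra `I^W(P)`: the Grothendieck ring of `C^W(P)`. -/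
abbrev EquivIncidenceAlgebra (k : Type u) [Field k] (W : Type v) [Group W] (P : Type u)
    [PartialOrder P] [MulAction W P] :=
  GrothendieckGroup (IntervalRep.SES (k := k) (W := W) (P := P))

namespace EquivIncidenceAlgebra

variable {k : Type u} [Field k] {W : Type v} [Group W] {P : Type u} [PartialOrder P]
  [MulAction W P]

/-- The class `[V]` of an object of `C^W(P)`. -/
abbrev mk (V : IntervalRep k W P) : EquivIncidenceAlgebra k W P :=
  GrothendieckGroup.mk IntervalRep.SES V

/-- The component `f_{xy} ∈ VRep(W_{xy})` of `f ∈ I^W(P)`; it is additive in `f` and given on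
objects by `[V]_{xy} = [V_{xy}]`. -/
def comp (x y : P) (h : x ≤ y) :
    EquivIncidenceAlgebra k W P →+ VRep k (IntervalRep.stab W x y) :=
  GrothendieckGroup.lift (fun V => GrothendieckGroup.mk FDRep.SES (V.rep x y h))
    fun _ _ _ hs => GrothendieckGroup.mk_ses (IntervalRep.rep_ses hs x y h)

variable [LocallyFiniteOrder P] [CovariantClass W P HSMul.hSMul LE.le]

/-- The biadditive product with `[U] [V] = [U ⊗ V]`. -/
def mulHom : EquivIncidenceAlgebra k W P →+
    EquivIncidenceAlgebra k W P →+ EquivIncidenceAlgebra k W P :=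
  GrothendieckGroup.lift
    (fun U => GrothendieckGroup.lift (fun V => mk (IntervalRep.tensor U V))
      fun _ _ _ hs => GrothendieckGroup.mk_ses (IntervalRep.tensor_ses_right U hs))
    fun _ _ _ hs => GrothendieckGroup.hom_ext fun V => by
      simpa using GrothendieckGroup.mk_ses (IntervalRep.tensor_ses_left V hs)

instance : Ring (EquivIncidenceAlgebra k W P) :=
  { (inferInstance : AddCommGroup (EquivIncidenceAlgebra k W P)) with
    mul := fun f g => mulHom f g
    one := mk IntervalRep.unit
    left_distrib := fun f g h => map_add (mulHom f) g h
    right_distrib := fun f g h => by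
      change mulHom (f + g) h = mulHom f h + mulHom g h
      rw [map_add, AddMonoidHom.add_apply]
    zero_mul := fun f => by
      change mulHom 0 f = 0
      rw [map_zero, AddMonoidHom.zero_apply]
    mul_zero := fun f => map_zero (mulHom f)
    mul_assoc := fun f g h => by
      have : AddMonoidHom.compr₂ mulHom mulHom =
          (AddMonoidHom.compHom.flip mulHom).comp (AddMonoidHom.compHom.comp
            (mulHom (k := k) (W := W) (P := P))) :=
        GrothendieckGroup.hom_ext fun A => GrothendieckGroup.hom_ext fun B =>
          GrothendieckGroup.hom_ext fun D => by
            simp [mulHom, IntervalRep.mk_tensor_assoc]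
      exact DFunLike.congr_fun (DFunLike.congr_fun (DFunLike.congr_fun this f) g) h
    one_mul := fun f => by
      have : mulHom (mk IntervalRep.unit) = AddMonoidHom.id (EquivIncidenceAlgebra k W P) :=
        GrothendieckGroup.hom_ext fun V => by simp [mulHom, IntervalRep.mk_unit_tensor]
      exact DFunLike.congr_fun this f
    mul_one := fun f => by
      have : mulHom.flip (mk IntervalRep.unit) =
          AddMonoidHom.id (EquivIncidenceAlgebra k W P) :=
        GrothendieckGroup.hom_ext fun V => by simp [mulHom, IntervalRep.mk_tensor_unit]
      exact DFunLike.congr_fun this f }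

theorem mk_mul_mk (U V : IntervalRep k W P) : mk U * mk V = mk (IntervalRep.tensor U V) := by
  change mulHom _ _ = _
  simp [mulHom]

theorem one_def : (1 : EquivIncidenceAlgebra k W P) = mk IntervalRep.unit := rfl

end EquivIncidenceAlgebra

/-! ### Equivariant Kazhdan--Lusztig--Stanley theory -/

/-- A `W`-invariant weak rank function on `P`; only the values `r x y` with `x ≤ y` matter. -/
structure WeakRankFunction (W : Type v) [Group W] (P : Type u) [PartialOrder P]
    [MulAction W P] where
  r : P → P → ℕ
  pos : ∀ {x y : P}, x < y → 0 < r x y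
  add : ∀ {x y z : P}, x ≤ y → y ≤ z → r x y + r y z = r x z
  smul : ∀ (σ : W) {x y : P}, x ≤ y → r (σ • x) (σ • y) = r x y

namespace EquivKLS

variable {k : Type u} [Field k] {W : Type v} [Group W] {P : Type u} [PartialOrder P]
  [LocallyFiniteOrder P] [MulAction W P] [CovariantClass W P HSMul.hSMul LE.le]

/-- The coefficient of `t ^ n` in `f_{xy}(t)`, an element of `VRep(W_{xy})`, for a series
`f = ∑ fₙ tⁿ` with `fₙ ∈ I^W(P)`. -/
def coeffAt (f : PowerSeries (EquivIncidenceAlgebra k W P)) (x y : P) (h : x ≤ y) (n : ℕ) :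
    VRep k (IntervalRep.stab W x y) :=
  EquivIncidenceAlgebra.comp x y h (PowerSeries.coeff n f)

/-- Membership in `𝓘^W(P)`: every `f_{xy}(t)` is a polynomial of degree at most `r_{xy}`. A
series with coefficients in `I^W(P)` is used in place of a polynomial because the degrees
`r_{xy}` need not be bounded when `P` is infinite. -/
def MemI (ρ : WeakRankFunction W P) (f : PowerSeries (EquivIncidenceAlgebra k W P)) : Prop :=
  ∀ x y (h : x ≤ y) n, ρ.r x y < n → coeffAt f x y h n = 0

/-- Membership in `𝓘^W_{1/2}(P)`: `deg f_{xy}(t) < r_{xy} / 2` for `x < y`, and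
`f_{xx}(t) = δ_{xx}(t)`, where `δ` is the unit. -/
def MemIHalf (ρ : WeakRankFunction W P) (f : PowerSeries (EquivIncidenceAlgebra k W P)) :
    Prop :=
  (∀ x y (h : x < y) n, ρ.r x y ≤ 2 * n → coeffAt f x y h.le n = 0) ∧
    ∀ x n, coeffAt f x x le_rfl n = coeffAt 1 x x le_rfl n

/-- The coefficient of `t ^ n` in `t ^ r_{xy} f_{xy}(t⁻¹)`. -/
def barCoeffAt (ρ : WeakRankFunction W P) (f : PowerSeries (EquivIncidenceAlgebra k W P))
    (x y : P) (h : x ≤ y) (n : ℕ) : VRep k (IntervalRep.stab W x y) :=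
  if n ≤ ρ.r x y then coeffAt f x y h (ρ.r x y - n) else 0

/-- `f'` is `f̄`, that is, `f'_{xy}(t) = t ^ r_{xy} f_{xy}(t⁻¹)` for all `x ≤ y`. -/
def IsBar (ρ : WeakRankFunction W P) (f f' : PowerSeries (EquivIncidenceAlgebra k W P)) :
    Prop :=
  ∀ x y (h : x ≤ y) n, coeffAt f' x y h n = barCoeffAt ρ f x y h n

/-- `κ` is a `P`-kernel: `κ ∈ 𝓘^W(P)`, `κ_{xx}(t) = δ_{xx}(t)`, and `κ̄` is inverse to `κ`. -/
structure IsPKernel (ρ : WeakRankFunction W P)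
    (κ : PowerSeries (EquivIncidenceAlgebra k W P)) : Prop where
  mem : MemI ρ κ
  diag : ∀ x n, coeffAt κ x x le_rfl n = coeffAt 1 x x le_rfl n
  bar_inv : ∃ κ', IsBar ρ κ κ' ∧ κ * κ' = 1 ∧ κ' * κ = 1

/-- `f` is the right equivariant KLS-function of `κ`: `f ∈ 𝓘^W_{1/2}(P)` and `f̄ = κ f`. -/
def IsRightKLS (ρ : WeakRankFunction W P)
    (κ f : PowerSeries (EquivIncidenceAlgebra k W P)) : Prop :=
  MemIHalf ρ f ∧ IsBar ρ f (κ * f)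

/-- `g` is the left equivariant KLS-function of `κ`: `g ∈ 𝓘^W_{1/2}(P)` and `ḡ = g κ`. -/
def IsLeftKLS (ρ : WeakRankFunction W P)
    (κ g : PowerSeries (EquivIncidenceAlgebra k W P)) : Prop :=
  MemIHalf ρ g ∧ IsBar ρ g (g * κ)

end EquivKLS

end

/-! The KLS equations say that `g * κ` is the bar of `g` and `κ * f` is the bar of `f`. Hence Z can
be read in two ways: as g · f̄ and as ḡ · f. If bar is a multiplicative involution, it carries the
first expression to the second, so Z is fixed. Boundedness of degree follows at once, since any
series that is the bar of another has degrees at most r.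

The substance is multiplicativity (`EquivKLS.IsBar.mul`). Bar is defined componentwise, with
exponent r depending on x and y, so the components of a product must be expressed through those of
its factors. Without a group action, the xz-component is the sum over y of products, and r_{xy} +
r_{yz} = r_{xz} makes each term reverse correctly. Equivariantly, W_{xz} permutes the summands, so a
single summand need not be a subrepresentation. Grouping the y in [x, z] by W_{xz}-orbits gives
instead the sum, over orbit representatives y, of the inductions from W_{xyz} to W_{xz} of the
tensor products of the restricted xy- and yz-components (`EquivIncidenceAlgebra.comp_mul`).

Each summand is biadditive in the two components, and reversal of coefficients uses nothing more
(`sum_antidiagonal_reverse`). In particular, independence of the chosen orbit representatives is not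
needed. Induction is modelled on functions from the orbit to the fibre, twisted by a
stabilizer-valued cocycle, so that it is visibly exact and finite dimensional; `VRep.of_bundle`
matches this model with sections of an equivariant bundle. -/

open scoped TensorProduct DirectSum

noncomputable section

/-! ### Classes of representations in the Grothendieck group -/

namespace VRep

variable {k : Type u} [Field k] {G : Type v} [Group G]

/-- The class of a finite dimensional representation. -/
def of {M : Type u} [AddCommGroup M] [Module k M] [Module.Finite k M]
    (ρ : Representation k G M) : VRep k G :=
  GrothendieckGroup.mk FDRep.SES (FDRep.of ρ)

section

variable {A B D : Type u} [AddCommGroup A] [Module k A] [Module.Finite k A]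
  [AddCommGroup B] [Module k B] [Module.Finite k B]
  [AddCommGroup D] [Module k D] [Module.Finite k D]

theorem of_ses {α : Representation k G A} {β : Representation k G B} {δ : Representation k G D}
    (i : A →ₗ[k] B) (p : B →ₗ[k] D) (hi : ∀ g a, i (α g a) = β g (i a))
    (hp : ∀ g b, p (β g b) = δ g (p b)) (h₁ : Function.Injective i) (h₂ : Function.Exact i p)
    (h₃ : Function.Surjective p) : of β = of α + of δ :=
  GrothendieckGroup.mk_ses ⟨i, p, hi, hp, h₁, h₂, h₃⟩

/-- The sequence 0 → A → A → A → 0 with identity maps is exact when A is trivial, which gives [A] =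
[A] + [A]. -/
theorem of_eq_zero [Subsingleton A] (α : Representation k G A) : of α = 0 := by
  have := of_ses (α := α) (β := α) (δ := α) LinearMap.id LinearMap.id (fun _ _ => rfl)
    (fun _ _ => rfl) Function.injective_id
    (fun a => ⟨fun _ => ⟨a, rfl⟩, fun _ => Subsingleton.elim _ _⟩) Function.surjective_id
  simpa using this

/-- An isomorphism is a short exact sequence with zero kernel term, here `PUnit`. -/
theorem of_congr {α : Representation k G A} {β : Representation k G B} (f : A →ₗ[k] B)
    (hf : ∀ g a, f (α g a) = β g (f a)) (h : Function.Bijective f) : of α = of β := by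
  have := of_ses (α := (1 : Representation k G PUnit.{u + 1})) (β := α) (δ := β) 0 f
    (fun g _ => (map_zero (α g)).symm) hf (fun _ _ _ => rfl)
    (fun b => ⟨fun hb => ⟨0, (h.1 (hb.trans (map_zero f).symm)).symm⟩, by
      rintro ⟨_, rfl⟩; exact map_zero f⟩) h.2
  rw [this, of_eq_zero (1 : Representation k G PUnit.{u + 1}), zero_add]

end

/-- The product of a family of representations. -/
def piRep {ι : Type u} {M : ι → Type u} [∀ i, AddCommGroup (M i)] [∀ i, Module k (M i)]
    (ρ : ∀ i, Representation k G (M i)) : Representation k G (∀ i, M i) where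
  toFun g := LinearMap.pi fun i => ρ i g ∘ₗ LinearMap.proj i
  map_one' := by ext; simp
  map_mul' g h := LinearMap.ext fun m => funext fun i => by simp

theorem piRep_apply {ι : Type u} {M : ι → Type u} [∀ i, AddCommGroup (M i)]
    [∀ i, Module k (M i)] (ρ : ∀ i, Representation k G (M i)) (g : G) (m : ∀ i, M i) (i : ι) :
    piRep ρ g m i = ρ i g (m i) := rfl

/-- Short exact sequences give additivity for two summands only; finite products follow by induction
on the index type, adding one element at a time. -/
theorem of_piRep {ι : Type u} [Fintype ι] {M : ι → Type u} [∀ i, AddCommGroup (M i)]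
    [∀ i, Module k (M i)] [∀ i, Module.Finite k (M i)] (ρ : ∀ i, Representation k G (M i)) :
    of (piRep ρ) = ∑ i, of (ρ i) := by
  revert M
  refine Fintype.induction_empty_option (P := fun ι [Fintype ι] => ∀ {M : ι → Type u}
    [∀ i, AddCommGroup (M i)] [∀ i, Module k (M i)] [∀ i, Module.Finite k (M i)]
    (ρ : ∀ i, Representation k G (M i)), of (piRep ρ) = ∑ i, of (ρ i)) ?_ ?_ ?_ ι
  · intro α β _ e ih M _ _ _ ρ
    let _ := Fintype.ofEquiv β e.symm
    rw [← e.sum_comp, ← ih fun a => ρ (e a)]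
    refine of_congr (LinearMap.pi fun a => LinearMap.proj (e a)) (fun _ _ => rfl)
      ⟨fun m m' h => funext fun b => ?_, fun m => ?_⟩
    · obtain ⟨a, rfl⟩ := e.surjective b
      exact congrFun h a
    · exact ⟨Equiv.piCongrLeft M e m, funext (Equiv.piCongrLeft_apply_apply M e m)⟩
  · intro M _ _ _ ρ
    rw [Finset.univ_eq_empty, Finset.sum_empty]
    exact of_eq_zero _
  · intro α _ ih M _ _ _ ρ
    classical
    rw [Fintype.sum_option, ← ih fun a => ρ (some a)]
    -- The `none` factor is the kernel of the projection onto the remaining factors.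
    refine of_ses (LinearMap.single k M none) (LinearMap.pi fun a => LinearMap.proj (some a))
      (fun g m => funext fun i => ?_) (fun _ _ => rfl) (Pi.single_injective none)
      (fun m => ⟨fun h => ⟨m none, funext fun i => ?_⟩, ?_⟩) fun m => ⟨fun i => ?_, ?_⟩
    · rw [piRep_apply]
      cases i <;> simp
    · cases i with
      | none => simp
      | some a => simpa using (congrFun h a).symm
    · rintro ⟨m, rfl⟩
      ext a
      simp
    · exact i.rec 0 m
    · rfl

/-! ### Tensor products and induction -/

section Tensor

variable {G₁ G₂ : Type v} [Group G₁] [Group G₂] (φ₁ : G →* G₁) (φ₂ : G →* G₂)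

/-- The biadditive map `([A], [B]) ↦ [A ⊗ B]`, where representations `A` of `G₁` and `B` of `G₂`
are pulled back to `G`. -/
def tensorRes : VRep k G₁ →+ VRep k G₂ →+ VRep k G :=
  GrothendieckGroup.lift
    (fun A => GrothendieckGroup.lift
      (fun B => of (Representation.tprod (A.ρ.comp φ₁) (B.ρ.comp φ₂)))
      fun _ _ _ ⟨i, p, hi, hp, h₁, h₂, h₃⟩ =>
        -- Over a field every module is flat, so tensoring preserves exact sequences; this makes the
        -- product well defined on classes.
        of_ses (LinearMap.lTensor A i) (LinearMap.lTensor A p)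
          (fun g => LinearMap.congr_fun (TensorProduct.ext' fun a b => by simp [hi] :
            LinearMap.lTensor A i ∘ₗ Representation.tprod _ _ g =
              Representation.tprod _ _ g ∘ₗ LinearMap.lTensor A i))
          (fun g => LinearMap.congr_fun (TensorProduct.ext' fun a b => by simp [hp] :
            LinearMap.lTensor A p ∘ₗ Representation.tprod _ _ g =
              Representation.tprod _ _ g ∘ₗ LinearMap.lTensor A p))
          (Module.Flat.lTensor_preserves_injective_linearMap _ h₁) (lTensor_exact _ h₂ h₃)
          (LinearMap.lTensor_surjective _ h₃))
    fun _ _ _ ⟨i, p, hi, hp, h₁, h₂, h₃⟩ => GrothendieckGroup.hom_ext fun B => by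
      simp only [AddMonoidHom.add_apply, GrothendieckGroup.lift_mk]
      exact of_ses (LinearMap.rTensor B i) (LinearMap.rTensor B p)
          (fun g => LinearMap.congr_fun (TensorProduct.ext' fun a b => by simp [hi] :
            LinearMap.rTensor B i ∘ₗ Representation.tprod _ _ g =
              Representation.tprod _ _ g ∘ₗ LinearMap.rTensor B i))
          (fun g => LinearMap.congr_fun (TensorProduct.ext' fun a b => by simp [hp] :
            LinearMap.rTensor B p ∘ₗ Representation.tprod _ _ g =
              Representation.tprod _ _ g ∘ₗ LinearMap.rTensor B p))
          (Module.Flat.rTensor_preserves_injective_linearMap _ h₁) (rTensor_exact _ h₂ h₃)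
          (LinearMap.rTensor_surjective _ h₃)

theorem tensorRes_mk (A : FDRep k G₁) (B : FDRep k G₂) :
    tensorRes φ₁ φ₂ (GrothendieckGroup.mk FDRep.SES A) (GrothendieckGroup.mk FDRep.SES B) =
      of (Representation.tprod (A.ρ.comp φ₁) (B.ρ.comp φ₂)) := by
  simp [tensorRes]

end Tensor

section Induction

variable {X : Type u} [MulAction G X] (y : X)

/-- An element of `G` taking `y` to a given point of its orbit. -/
def transporter (b : MulAction.orbit G y) : G := b.2.choose

theorem transporter_smul (b : MulAction.orbit G y) : transporter y b • y = b.1 :=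
  b.2.choose_spec

theorem transporter_inv_smul (b : MulAction.orbit G y) : (transporter y b)⁻¹ • b.1 = y := by
  rw [inv_smul_eq_iff, transporter_smul]

/-- The cocycle with values in the stabilizer of `y` that is defined by the choice of
transporters. -/
def cocycle (g : G) (b : MulAction.orbit G y) : MulAction.stabilizer G y :=
  ⟨(transporter y b)⁻¹ * g * transporter y (g⁻¹ • b), by
    rw [MulAction.mem_stabilizer_iff, mul_smul, transporter_smul, mul_smul,
      MulAction.orbit.coe_smul, smul_inv_smul, transporter_inv_smul]⟩

theorem cocycle_one (b : MulAction.orbit G y) : cocycle y 1 b = 1 := by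
  ext
  simp [cocycle]

/-- The inner transporters to g⁻¹b cancel. This identity is what makes `indRep` multiplicative. -/
theorem cocycle_mul (g h : G) (b : MulAction.orbit G y) :
    cocycle y (g * h) b = cocycle y g b * cocycle y h (g⁻¹ • b) := by
  ext
  simp [cocycle, mul_assoc, mul_smul]

variable {M : Type u} [AddCommGroup M] [Module k M]

/-- The representation of `G` induced from a representation of the stabilizer of `y`, on the
functions on the orbit of `y`. -/
def indRep (ρ : Representation k (MulAction.stabilizer G y) M) :
    Representation k G (MulAction.orbit G y → M) where
  toFun g := LinearMap.pi fun b => ρ (cocycle y g b) ∘ₗ LinearMap.proj (g⁻¹ • b)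
  map_one' := LinearMap.ext fun m => funext fun b => by simp [cocycle_one]
  map_mul' g h := LinearMap.ext fun m => funext fun b => by
    simp [cocycle_mul, mul_smul]

theorem indRep_apply (ρ : Representation k (MulAction.stabilizer G y) M) (g : G)
    (m : MulAction.orbit G y → M) (b : MulAction.orbit G y) :
    indRep y ρ g m b = ρ (cocycle y g b) (m (g⁻¹ • b)) := rfl

variable [Finite X]

/-- Induction of virtual representations from the stabilizer of `y`. -/
def ind : VRep k (MulAction.stabilizer G y) →+ VRep k G :=
  GrothendieckGroup.lift (fun A => of (indRep y A.ρ))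
    fun _ _ _ ⟨i, p, hi, hp, h₁, h₂, h₃⟩ =>
      of_ses (i.compLeft _) (p.compLeft _) (fun _ _ => funext fun _ => hi _ _)
        (fun _ _ => funext fun _ => hp _ _) h₁.comp_left
        -- Exactness is checked pointwise on the orbit, with a preimage chosen at each point.
        (fun m => ⟨fun h => ⟨fun b => ((h₂ (m b)).1 (congrFun h b)).choose,
            funext fun b => ((h₂ (m b)).1 (congrFun h b)).choose_spec⟩, by
          rintro ⟨m, rfl⟩
          exact funext fun b => h₂.apply_apply_eq_zero (m b)⟩)
        h₃.comp_left

theorem ind_of [Module.Finite k M] (ρ : Representation k (MulAction.stabilizer G y) M) :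
    ind y (of ρ) = of (indRep y ρ) :=
  GrothendieckGroup.lift_mk _ _ _

end Induction

/-! ### Equivariant bundles over a finite `G`-set -/

section Bundle

variable {X : Type u} [MulAction G X] {E : X → Type u} [∀ a, AddCommGroup (E a)]
  [∀ a, Module k (E a)] (α : ∀ (g : G) {a b : X}, g • a = b → E a →ₗ[k] E b)
  (α_one : ∀ {a : X} (h : (1 : G) • a = a) (v : E a), α 1 h v = v)
  (α_mul : ∀ (g g' : G) {a b c : X} (h : g' • a = b) (h' : g • b = c) (h'' : (g * g') • a = c)
    (v : E a), α g h' (α g' h v) = α (g * g') h'' v)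

/-- The representation of the stabilizer of `y` on the fibre at `y` of an equivariant bundle. -/
def fibreRep (y : X) : Representation k (MulAction.stabilizer G y) (E y) where
  toFun g := α g.1 g.2
  map_one' := LinearMap.ext fun v => α_one _ v
  map_mul' g h := LinearMap.ext fun v => (α_mul g.1 h.1 h.2 g.2 (g * h).2 v).symm

variable [Finite X] [∀ a, Module.Finite k (E a)] [Fintype (MulAction.orbitRel.Quotient G X)]

/-- The sections of an equivariant bundle are the sum, over the orbits, of the representations
induced from the fibres. -/
theorem of_bundle {M : Type u} [AddCommGroup M] [Module k M] [Module.Finite k M]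
    (ρ : Representation k G M) (e : M ≃ₗ[k] ∀ a, E a)
    (he : ∀ (g : G) (m : M) {a b : X} (h : g • a = b), e (ρ g m) b = α g h (e m a)) :
    of ρ = ∑ ω : MulAction.orbitRel.Quotient G X,
      ind ω.out (of (fibreRep α α_one α_mul ω.out)) := by
  -- The type of α g h involves g through the proof h, so equal group elements are exchanged by this
  -- lemma rather than by rewriting.
  have α_congr : ∀ {g g' : G} {a b : X} (h : g • a = b) (h' : g' • a = b) (v : E a), g = g' →
      α g h v = α g' h' v := by
    rintro g _ a b h h' v rfl
    rfl
  have cancel : ∀ (g : G) {a b : X} (h : g • a = b) (h' : g⁻¹ • b = a) (v : E a),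
      α g⁻¹ h' (α g h v) = v := fun g a b h h' v => by
    rw [α_mul g⁻¹ g h h' (by rw [inv_mul_cancel, one_smul]),
      α_congr _ (one_smul G a) v (inv_mul_cancel g), α_one]
  have cancel' : ∀ (g : G) {a b : X} (h : g • a = b) (h' : g⁻¹ • b = a) (v : E b),
      α g h (α g⁻¹ h' v) = v := fun g a b h h' v => by
    rw [α_mul g g⁻¹ h' h (by rw [mul_inv_cancel, one_smul]),
      α_congr _ (one_smul G b) v (mul_inv_cancel g), α_one]
  have mem : ∀ a : X, a ∈ MulAction.orbit G
      (Quotient.mk'' a : MulAction.orbitRel.Quotient G X).out := fun a =>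
    MulAction.orbitRel_apply.1 (Setoid.symm' _ (Quotient.mk_out (s := MulAction.orbitRel G X) a))
  simp_rw [ind_of]
  rw [← of_piRep]
  -- A section is recorded orbit by orbit: its value at b is carried back to the fibre over the
  -- representative by the inverse transporter.
  let F : M →ₗ[k] ∀ ω : MulAction.orbitRel.Quotient G X, MulAction.orbit G ω.out → E ω.out :=
    LinearMap.pi fun ω => LinearMap.pi fun b =>
      α (transporter ω.out b)⁻¹ (transporter_inv_smul ω.out b) ∘ₗ LinearMap.proj b.1 ∘ₗ e.toLinearMap
  have hF : ∀ m ω b, F m ω b =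
      α (transporter ω.out b)⁻¹ (transporter_inv_smul ω.out b) (e m b.1) := fun _ _ _ => rfl
  refine of_congr F (fun g m => funext fun ω => funext fun b => ?_) ⟨?_, fun ψ => ?_⟩
  · have hb : g • (g⁻¹ • b.1) = b.1 := smul_inv_smul _ _
    rw [piRep_apply, indRep_apply, hF, hF, he g m hb]
    -- With t the transporter, both sides are the action of t_b⁻¹g on the value at g⁻¹b; on the
    -- induced side the factor t at g⁻¹b in the cocycle cancels its inverse coming from `F`.
    have h1 : ((transporter ω.out b)⁻¹ * g) • (g⁻¹ • b.1) = ω.out := by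
      rw [mul_smul, hb, transporter_inv_smul]
    refine (α_mul _ _ _ _ h1 _).trans (.symm ?_)
    refine (α_mul _ _ _ _ ?_ _).trans (α_congr _ _ _ ?_)
    · simp only [cocycle, mul_assoc, mul_inv_cancel, mul_one]
      exact h1
    · simp [cocycle, mul_assoc]
  · intro m m' h
    refine e.injective (funext fun a => ?_)
    have := congrFun (congrFun h (Quotient.mk'' a)) ⟨a, mem a⟩
    rw [hF, hF] at this
    have := congrArg (α _ (transporter_smul _ ⟨a, mem a⟩)) this
    rwa [cancel', cancel'] at this
  -- The preimage of ψ pushes each value out from the representative along the transporter.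
  · refine ⟨e.symm fun a => α _ (transporter_smul _ ⟨a, mem a⟩) (ψ _ ⟨a, mem a⟩),
      funext fun ω => funext fun ⟨a, ha⟩ => ?_⟩
    have hω : ω = Quotient.mk'' a := by
      rw [← Quotient.out_eq' ω]
      exact Quotient.sound' (Setoid.symm' _ (MulAction.orbitRel_apply.2 ha))
    subst hω
    rw [hF, e.apply_symm_apply, cancel]

end Bundle

end VRep

/-! ### Components of a product -/

namespace IntervalRep

variable {k : Type u} [Field k] {W : Type v} [Group W] {P : Type u} [PartialOrder P]
  [MulAction W P] [CovariantClass W P HSMul.hSMul LE.le]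

instance stabMulActionIcc (x z : P) : MulAction (stab W x z) (Set.Icc x z) where
  smul σ y := ⟨σ.1 • y.1, mem_Icc_smul σ.1 σ.2.1 σ.2.2 y⟩
  one_smul y := Subtype.ext (one_smul W y.1)
  mul_smul σ τ y := Subtype.ext (mul_smul σ.1 τ.1 y.1)

/-- The inclusion `W_{xyz} → W_{xy}`. -/
def stabLeft {x z : P} (y : Set.Icc x z) :
    MulAction.stabilizer (stab W x z) y →* stab W x y.1 where
  toFun σ := ⟨σ.1.1, σ.1.2.1, congrArg Subtype.val σ.2⟩
  map_one' := rfl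
  map_mul' _ _ := rfl

/-- The inclusion `W_{xyz} → W_{yz}`. -/
def stabRight {x z : P} (y : Set.Icc x z) :
    MulAction.stabilizer (stab W x z) y →* stab W y.1 z where
  toFun σ := ⟨σ.1.1, congrArg Subtype.val σ.2, σ.1.2.2⟩
  map_one' := rfl
  map_mul' _ _ := rfl

variable [LocallyFiniteOrder P]

instance (x z : P) : Fintype (MulAction.orbitRel.Quotient (stab W x z) (Set.Icc x z)) :=
  Fintype.ofFinite _

/-- The spaces U_{xy} ⊗ V_{yz} form a W_{xz}-equivariant bundle over the finite set [x, z], and (U ⊗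
V)_{xz} is its space of sections, so `VRep.of_bundle` applies. -/
theorem mk_rep_tensor (U V : IntervalRep k W P) (x z : P) (h : x ≤ z) :
    GrothendieckGroup.mk FDRep.SES ((tensor U V).rep x z h) =
      ∑ ω : MulAction.orbitRel.Quotient (stab W x z) (Set.Icc x z),
        VRep.ind ω.out (VRep.tensorRes (stabLeft ω.out) (stabRight ω.out)
          (GrothendieckGroup.mk FDRep.SES (U.rep x ω.out.1 ω.out.2.1))
          (GrothendieckGroup.mk FDRep.SES (V.rep ω.out.1 z ω.out.2.2))) := by
  classical
  simp_rw [VRep.tensorRes_mk]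
  let E : Set.Icc x z → Type u := fun y => U.V x y y.2.1 ⊗[k] V.V y z y.2.2
  let α : ∀ (σ : stab W x z) {a b : Set.Icc x z}, σ • a = b → E a →ₗ[k] E b :=
    fun σ a b hab => TensorProduct.map
      (U.act σ.1 σ.2.1 (congrArg Subtype.val hab) a.2.1 b.2.1)
      (V.act σ.1 (congrArg Subtype.val hab) σ.2.2 a.2.2 b.2.2)
  have α_one : ∀ {a : Set.Icc x z} (h : (1 : stab W x z) • a = a) (v : E a), α 1 h v = v := by
    intro a h v
    refine LinearMap.congr_fun (g := LinearMap.id) (TensorProduct.ext' fun u w => ?_) v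
    exact congrArg₂ (· ⊗ₜ[k] ·) (U.act_one _ _ _ u) (V.act_one _ _ _ w)
  have α_mul : ∀ (σ τ : stab W x z) {a b c : Set.Icc x z} (h : τ • a = b) (h' : σ • b = c)
      (h'' : (σ * τ) • a = c) (v : E a), α σ h' (α τ h v) = α (σ * τ) h'' v := by
    intro σ τ a b c h h' h'' v
    refine LinearMap.congr_fun (f := α σ h' ∘ₗ α τ h) (TensorProduct.ext' fun u w => ?_) v
    exact congrArg₂ (· ⊗ₜ[k] ·) (U.act_mul _ _ _ _ _ _ _ _ _ _ _ u)
      (V.act_mul _ _ _ _ _ _ _ _ _ _ _ w)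
  let ρ : Representation k (stab W x z) (⨁ y, E y) :=
    { toFun := fun σ => (tensor U V).act σ.1 σ.2.1 σ.2.2 h h
      map_one' := LinearMap.ext fun v => (tensor U V).act_one _ _ h v
      map_mul' := fun τ σ => LinearMap.ext fun v =>
        ((tensor U V).act_mul τ.1 σ.1 σ.2.1 σ.2.2 τ.2.1 τ.2.2 (τ * σ).2.1 (τ * σ).2.2
          h h h v).symm }
  -- The fibre representation at an orbit representative is definitionally the tensor product pulled
  -- back along `stabLeft` and `stabRight`.
  refine (VRep.of_bundle α α_one α_mul ρ (DirectSum.linearEquivFunOnFintype k _ E)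
    fun σ m a b hab => ?_).trans (Finset.sum_congr rfl fun ω _ => rfl)
  refine LinearMap.congr_fun (f := LinearMap.proj b ∘ₗ
      (DirectSum.linearEquivFunOnFintype k _ E).toLinearMap ∘ₗ ρ σ)
    (g := α σ hab ∘ₗ LinearMap.proj a ∘ₗ (DirectSum.linearEquivFunOnFintype k _ E).toLinearMap)
    (tensor_hom_ext fun y u v => ?_) m
  have hy : σ.1 • y.1 = (σ • y).1 := rfl
  simp only [LinearMap.comp_apply, LinearMap.proj_apply, LinearEquiv.coe_coe]
  rw [show ρ σ (DirectSum.lof k _ E y (u ⊗ₜ v)) = DirectSum.lof k _ E (σ • y)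
      (U.act σ.1 σ.2.1 hy y.2.1 (σ • y).2.1 u ⊗ₜ V.act σ.1 hy σ.2.2 y.2.2 (σ • y).2.2 v) from
    tensor_act_lof U V σ.1 σ.2.1 σ.2.2 h h y (σ • y) hy u v]
  refine (congrFun (DirectSum.linearEquivFunOnFintype_lof ..) b).trans
    (.trans ?_ (congrArg (α σ hab) (congrFun (DirectSum.linearEquivFunOnFintype_lof ..) a)).symm)
  subst hab
  -- An element supported at y moves to one supported at σy, so its component at σa vanishes unless
  -- a = y.
  by_cases hya : a = y
  · subst hya
    rw [Pi.single_eq_same, Pi.single_eq_same]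
    rfl
  · rw [Pi.single_eq_of_ne hya, Pi.single_eq_of_ne fun e => hya (MulAction.injective σ e),
      map_zero]

end IntervalRep

/-- Both sides are biadditive in f and g, so it suffices to compare them on classes of objects,
where this is `IntervalRep.mk_rep_tensor`. -/
theorem EquivIncidenceAlgebra.comp_mul {k : Type u} [Field k] {W : Type v} [Group W]
    {P : Type u} [PartialOrder P] [MulAction W P] [LocallyFiniteOrder P]
    [CovariantClass W P HSMul.hSMul LE.le] (f g : EquivIncidenceAlgebra k W P) (x z : P)
    (h : x ≤ z) :
    comp x z h (f * g) =
      ∑ ω : MulAction.orbitRel.Quotient (IntervalRep.stab W x z) (Set.Icc x z),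
        VRep.ind ω.out (VRep.tensorRes (IntervalRep.stabLeft ω.out)
          (IntervalRep.stabRight ω.out) (comp x ω.out.1 ω.out.2.1 f)
          (comp ω.out.1 z ω.out.2.2 g)) := by
  let Φ : EquivIncidenceAlgebra k W P →+ EquivIncidenceAlgebra k W P →+
      VRep k (IntervalRep.stab W x z) :=
    ∑ ω : MulAction.orbitRel.Quotient (IntervalRep.stab W x z) (Set.Icc x z),
      ((VRep.tensorRes (IntervalRep.stabLeft ω.out) (IntervalRep.stabRight ω.out)).compl₂
        (comp ω.out.1 z ω.out.2.2) |>.comp (comp x ω.out.1 ω.out.2.1)).compr₂ (VRep.ind ω.out)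
  have : (mulHom (k := k) (W := W) (P := P)).compr₂ (comp x z h) = Φ :=
    GrothendieckGroup.hom_ext fun U => GrothendieckGroup.hom_ext fun V => by
      refine (congrArg (comp x z h) (mk_mul_mk U V)).trans ?_
      refine (GrothendieckGroup.lift_mk _ _ _).trans ((IntervalRep.mk_rep_tensor U V x z h).trans ?_)
      simp [Φ, comp]
  refine (DFunLike.congr_fun (DFunLike.congr_fun this f) g).trans ?_
  simp [Φ]

/-! ### The bar involution -/

/-- This is t^{r+s}(ab)(t⁻¹) = t^r a(t⁻¹) · t^s b(t⁻¹) for a product given by an arbitrary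
biadditive map. The reflection (i, j) ↦ (r − i, s − j) exchanges the antidiagonals of n and r + s −
n inside the rectangle i ≤ r, j ≤ s. -/
theorem sum_antidiagonal_reverse {A B C : Type*} [AddCommGroup A] [AddCommGroup B]
    [AddCommGroup C] (Φ : A →+ B →+ C) {r s : ℕ} {a a' : ℕ → A} {b b' : ℕ → B}
    (ha : ∀ i, r < i → a i = 0) (hb : ∀ j, s < j → b j = 0)
    (ha' : ∀ i, a' i = if i ≤ r then a (r - i) else 0)
    (hb' : ∀ j, b' j = if j ≤ s then b (s - j) else 0) (n : ℕ) :
    ∑ p ∈ Finset.HasAntidiagonal.antidiagonal n, Φ (a' p.1) (b' p.2) =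
      if n ≤ r + s then ∑ p ∈ Finset.HasAntidiagonal.antidiagonal (r + s - n), Φ (a p.1) (b p.2) else 0 := by
  have hl : ∀ p : ℕ × ℕ, Φ (a' p.1) (b' p.2) ≠ 0 → p.1 ≤ r ∧ p.2 ≤ s := fun p hp => by
    by_contra hc
    rw [not_and_or] at hc
    rcases hc with hc | hc
    · exact hp (by rw [ha', if_neg hc, map_zero, AddMonoidHom.zero_apply])
    · exact hp (by rw [hb', if_neg hc, map_zero])
  have hr : ∀ p : ℕ × ℕ, Φ (a p.1) (b p.2) ≠ 0 → p.1 ≤ r ∧ p.2 ≤ s := fun p hp => by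
    by_contra hc
    rw [not_and_or, not_le, not_le] at hc
    rcases hc with hc | hc
    · exact hp (by rw [ha _ hc, map_zero, AddMonoidHom.zero_apply])
    · exact hp (by rw [hb _ hc, map_zero])
  split_ifs with hn
  -- Terms outside the rectangle vanish. They are discarded first because truncated subtraction
  -- makes the reflection an involution only inside it.
  · rw [← Finset.sum_filter_of_ne (p := fun p => p.1 ≤ r ∧ p.2 ≤ s) fun p _ => hl p,
      ← Finset.sum_filter_of_ne (p := fun p => p.1 ≤ r ∧ p.2 ≤ s) fun p _ => hr p]
    refine Finset.sum_nbij' (fun p => (r - p.1, s - p.2)) (fun p => (r - p.1, s - p.2))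
      ?_ ?_ ?_ ?_ ?_
    all_goals
      rintro ⟨i, j⟩ hp
      simp only [Finset.mem_filter, Finset.HasAntidiagonal.mem_antidiagonal, Prod.mk.injEq] at hp ⊢
    · omega
    · omega
    · omega
    · omega
    · rw [ha', hb', if_pos hp.2.1, if_pos hp.2.2]
  · refine Finset.sum_eq_zero fun p hp => by_contra fun hc => hn ?_
    have := hl p hc
    rw [Finset.HasAntidiagonal.mem_antidiagonal] at hp
    omega

namespace EquivKLS

variable {k : Type u} [Field k] {W : Type v} [Group W] {P : Type u} [PartialOrder P]
  [LocallyFiniteOrder P] [MulAction W P] [CovariantClass W P HSMul.hSMul LE.le]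
  {ρ : WeakRankFunction W P} {f f' g g' : PowerSeries (EquivIncidenceAlgebra k W P)}

theorem coeffAt_mul (f g : PowerSeries (EquivIncidenceAlgebra k W P)) (x z : P) (h : x ≤ z)
    (n : ℕ) :
    coeffAt (f * g) x z h n =
      ∑ ω : MulAction.orbitRel.Quotient (IntervalRep.stab W x z) (Set.Icc x z),
        ∑ p ∈ Finset.HasAntidiagonal.antidiagonal n,
          (VRep.tensorRes (IntervalRep.stabLeft ω.out) (IntervalRep.stabRight ω.out)).compr₂
            (VRep.ind ω.out) (coeffAt f x ω.out.1 ω.out.2.1 p.1)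
            (coeffAt g ω.out.1 z ω.out.2.2 p.2) := by
  rw [coeffAt, PowerSeries.coeff_mul, map_sum, Finset.sum_comm]
  exact Finset.sum_congr rfl fun p _ => EquivIncidenceAlgebra.comp_mul _ _ x z h

theorem MemIHalf.memI (hf : MemIHalf ρ f) : MemI ρ f := by
  intro x y h n hn
  rcases h.lt_or_eq with hlt | rfl
  · exact hf.1 x y hlt n (by omega)
  · rw [hf.2, coeffAt, PowerSeries.coeff_one, if_neg (by omega), map_zero]

theorem IsBar.memI (h : IsBar ρ f f') : MemI ρ f' := fun x y hxy n hn => by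
  rw [h, barCoeffAt, if_neg (by omega)]

/-- Reversal forgets coefficients beyond degree r, so it is undone by a second reversal only under
the degree bound on f. -/
theorem IsBar.symm (h : IsBar ρ f f') (hf : MemI ρ f) : IsBar ρ f' f := fun x y hxy n => by
  rw [barCoeffAt]
  split_ifs with hn
  · rw [h, barCoeffAt, if_pos (Nat.sub_le _ _), Nat.sub_sub_self hn]
  · exact hf x y hxy n (by omega)

/-- The bar involution is multiplicative. -/
theorem IsBar.mul (hf : MemI ρ f) (hg : MemI ρ g) (hff' : IsBar ρ f f') (hgg' : IsBar ρ g g') :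
    IsBar ρ (f * g) (f' * g') := by
  intro x z h n
  -- The condition n ≤ r_{xz} is moved inside the sum over orbits, so that each orbit can be treated
  -- separately.
  rw [barCoeffAt, coeffAt_mul, coeffAt_mul, ← Finset.sum_const_zero, ← Finset.sum_ite_irrel]
  refine Finset.sum_congr rfl fun ω _ => ?_
  rw [← ρ.add ω.out.2.1 ω.out.2.2]
  exact sum_antidiagonal_reverse _ (hf x ω.out.1 ω.out.2.1) (hg ω.out.1 z ω.out.2.2)
    (hff' x ω.out.1 ω.out.2.1) (hgg' ω.out.1 z ω.out.2.2) n

end EquivKLS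

end

theorem mainTheorem4 {k : Type u} [Field k] {W : Type v} [Group W] [Finite W]
    {P : Type u} [PartialOrder P] [LocallyFiniteOrder P] [MulAction W P]
    [CovariantClass W P HSMul.hSMul LE.le] (ρ : WeakRankFunction W P)
    (κ f g : PowerSeries (EquivIncidenceAlgebra k W P))
    (hκ : EquivKLS.IsPKernel ρ κ) (hf : EquivKLS.IsRightKLS ρ κ f)
    (hg : EquivKLS.IsLeftKLS ρ κ g) :
    EquivKLS.MemI ρ (g * κ * f) ∧ EquivKLS.IsBar ρ (g * κ * f) (g * κ * f) := by
  -- Bar takes g to `g * κ`, and takes `κ * f` back to f, so g(κf) goes to (gκ)f; associativity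
  -- identifies the two.
  have h := EquivKLS.IsBar.mul hg.1.memI hf.2.memI hg.2 (hf.2.symm hf.1.memI)
  rw [← mul_assoc] at h
  exact ⟨h.memI, h⟩
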